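/- A binary $[n,k]$ code is a $k$-dimensional subspace $C$ of $\mathbb{F}_2^n$. Its minimum weight is the smallest number of nonzero coordinates of a nonzero vector of $C$, and its dual is $C^\perp=\{x\in\mathbb{F}_2^n : \sum_{i=1}^n x_iy_i=0 \text{ for all } y\in C\}$. The code $C$ is linear complementary dual (LCD) if $C\cap C^\perp=\{0\}$. Let $d_2(n,k)$ denote the largest minimum weight among all binary LCD $[n,k]$ codes. Theorem. Let $n\ge 5$ be an integer. If $n\equiv 1,9,13,15,17,21,23,24,25,27,28,29,30 \pmod{31}$, then $$d_2(n,5)=\left\lfloor \frac{16n}{31}\right\rfloor-1.$$ If $n\equiv 0,6 \pmod{31}$, then $$d_2(n,5)=\left\lfloor \frac{16n}{31}\right\rfloor-2.$$ -/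

import Mathlib

/-- The (Euclidean) dual code `C^⊥ = {x | ⟨x, y⟩ = 0 for all y ∈ C}` of a linear code `C`
of length `n` over `F`, where `⟨x, y⟩ = ∑ i, x i * y i`. -/
def dualCode {F : Type*} [Field F] {n : ℕ} (C : Submodule F (Fin n → F)) :
    Submodule F (Fin n → F) where
  carrier := {x | ∀ y ∈ C, ∑ i, x i * y i = 0}
  zero_mem' := by
    intro y _
    simp
  add_mem' := by
    intro a b ha hb y hy
    simp only [Pi.add_apply, add_mul, Finset.sum_add_distrib]
    rw [ha y hy, hb y hy, add_zero]
  smul_mem' := by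
    intro c a ha y hy
    simp only [Pi.smul_apply, smul_eq_mul, mul_assoc, ← Finset.mul_sum]
    rw [ha y hy, mul_zero]

/-- A linear code is linear complementary dual (LCD) if `C ∩ C^⊥ = {0}`. -/
def IsLCD {F : Type*} [Field F] {n : ℕ} (C : Submodule F (Fin n → F)) : Prop :=
  C ⊓ dualCode C = ⊥

/-- The minimum weight of a code: the smallest Hamming weight of a nonzero codeword. -/
noncomputable def minWeight {F : Type*} [Field F] [DecidableEq F] {n : ℕ}
    (C : Submodule F (Fin n → F)) : ℕ :=
  sInf {w | ∃ x ∈ C, x ≠ 0 ∧ hammingNorm x = w}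

/-- The minimum weights of all LCD `[n, k]` codes over `F`. -/
def lcdMinWeights (F : Type*) [Field F] [DecidableEq F] (n k : ℕ) : Set ℕ :=
  {d | ∃ C : Submodule F (Fin n → F), Module.finrank F C = k ∧ IsLCD C ∧ minWeight C = d}

/-- `d_q(n, k)`, for `F` the field with `q` elements: the largest minimum weight among all
LCD `[n, k]` codes over `F`. -/
noncomputable def largestLCDMinWeight (F : Type*) [Field F] [DecidableEq F] (n k : ℕ) : ℕ :=
  sSup (lcdMinWeights F n k)

theorem minWeight_le_length {F : Type*} [Field F] [DecidableEq F] {n : ℕ}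
    (C : Submodule F (Fin n → F)) : minWeight C ≤ n := by
  unfold minWeight
  rcases Set.eq_empty_or_nonempty {w | ∃ x ∈ C, x ≠ 0 ∧ hammingNorm x = w} with h | ⟨w, hw⟩
  · rw [h]
    simp
  · refine (Nat.sInf_le hw).trans ?_
    obtain ⟨x, _, _, rfl⟩ := hw
    simpa using hammingNorm_le_card_fintype (x := x)

/-- The supremum defining `d_q(n, k)` is attained as soon as an LCD `[n, k]` code exists. -/
theorem isGreatest_largestLCDMinWeight {F : Type*} [Field F] [DecidableEq F] {n k : ℕ}
    (h : (lcdMinWeights F n k).Nonempty) :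
    IsGreatest (lcdMinWeights F n k) (largestLCDMinWeight F n k) := by
  have hb : BddAbove (lcdMinWeights F n k) := by
    refine ⟨n, ?_⟩
    rintro d ⟨C, _, _, rfl⟩
    exact minWeight_le_length C
  exact ⟨Nat.sSup_mem h hb, fun d hd => le_csSup hb hd⟩

/-! Both cases say that d₂(n,5) = ⌊(16n − 35)/31⌋. Explicit codes and copies of the simplex code
give the lower bound; the upper bound is `lcd_bound`.

For the upper bound, suppose 16n ≤ 31d + 34. Halving and rounding down the excess weights wt(u) − d
over nonzero u gives multiplicities e(u) on 𝔽₂⁵ with total at most 9. Weight sums over complements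
of hyperplanes are multiples of 8, so e has a multiple of 4 elements off every hyperplane. Second
moments then give (∑e)² + ∑e² ≡ 0 mod 4 and exclude total 9.

LCD means that the Gram form is nondegenerate, so the Gauss sum ∑ i^wt(u) has squared modulus 32 and
real part ±4. Its real part sees only even weights, that is u in h^⊥ for the row sum h, which is
nonzero. This fixes the number of odd e(u) on h^⊥: 6 or 10 for even total, 5 or 9 for odd total.
With total at most 8, all of e must lie on h^⊥, so ∑e² is congruent to that number mod 4,
contradicting the moment congruence. -/

/-- The integer `0` or `1` representing an element of `ZMod 2`. -/
def bit (a : ZMod 2) : ℤ := a.val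

/-- The quadratic character sign `(-1) ^ a` of an element of `ZMod 2`. -/
def sgn (a : ZMod 2) : ℤ := 1 - 2 * bit a

theorem bit_zero : bit 0 = 0 := rfl

theorem bit_eq_zero_or_one (a : ZMod 2) : bit a = 0 ∨ bit a = 1 := by
  revert a; decide

theorem bit_nonneg (a : ZMod 2) : 0 ≤ bit a := by
  revert a; decide

theorem bit_mul_self (a : ZMod 2) : bit a * bit a = bit a := by
  revert a; decide

theorem bit_add (a b : ZMod 2) : bit (a + b) = bit a + bit b - 2 * (bit a * bit b) := by
  revert a b; decide

theorem sgn_add (a b : ZMod 2) : sgn (a + b) = sgn a * sgn b := by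
  revert a b; decide

theorem four_mul_bit_mul_bit (a b : ZMod 2) :
    4 * (bit a * bit b) = 1 - sgn a - sgn b + sgn (a + b) := by
  revert a b; decide

theorem bit_cast (a : ZMod 2) : ((bit a : ℤ) : ZMod 2) = a := by
  revert a; decide

/-- A nontrivial additive character of an elementary abelian `2`-group sums to zero. -/
theorem sum_sgn_eq_zero {V : Type*} [AddCommGroup V] [Fintype V] (f : V →+ ZMod 2) {v : V}
    (hv : f v ≠ 0) : ∑ u, sgn (f u) = 0 := by
  have h1 : sgn (f v) = -1 := by
    have : ∀ a : ZMod 2, a ≠ 0 → sgn a = -1 := by decide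
    exact this _ hv
  have h2 : ∑ u, sgn (f u) = ∑ u, sgn (f (u + v)) :=
    (Equiv.sum_comp (Equiv.addRight v) fun u => sgn (f u)).symm
  simp only [map_add, sgn_add, h1, ← Finset.sum_mul] at h2
  linarith

theorem sum_sgn_dotProduct (x : Fin 5 → ZMod 2) :
    ∑ u : Fin 5 → ZMod 2, sgn (x ⬝ᵥ u) = if x = 0 then 32 else 0 := by
  split_ifs with h
  · subst h
    simp [sgn, bit_zero]
  · obtain ⟨v, hv⟩ : ∃ v, x ⬝ᵥ v ≠ 0 := by
      by_contra! hc
      exact h (dotProduct_eq_zero x hc)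
    exact sum_sgn_eq_zero (AddMonoidHom.mk' (fun u => x ⬝ᵥ u) (dotProduct_add x)) hv

/-- The number of `u` with `x ⬝ᵥ u = y ⬝ᵥ u = 1`. -/
theorem sum_bit_mul_bit (x y : Fin 5 → ZMod 2) :
    ∑ u : Fin 5 → ZMod 2, bit (x ⬝ᵥ u) * bit (y ⬝ᵥ u) =
      if x = 0 ∨ y = 0 then 0 else if x = y then 16 else 8 := by
  have h : 4 * ∑ u : Fin 5 → ZMod 2, bit (x ⬝ᵥ u) * bit (y ⬝ᵥ u) =
      32 - (if x = 0 then 32 else 0) - (if y = 0 then 32 else 0) +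
        (if x + y = 0 then 32 else 0) := by
    simp only [Finset.mul_sum, four_mul_bit_mul_bit, ← add_dotProduct, Finset.sum_add_distrib,
      Finset.sum_sub_distrib, sum_sgn_dotProduct]
    simp
  have hxy : x + y = 0 ↔ x = y := by
    rw [add_eq_zero_iff_eq_neg]
    simp [ZModModule.neg_eq_self]
  simp only [hxy] at h
  by_cases hx : x = 0 <;> by_cases hy : y = 0 <;> by_cases he : x = y <;>
    simp_all <;> linarith

theorem sum_bit (x : Fin 5 → ZMod 2) :
    ∑ u : Fin 5 → ZMod 2, bit (x ⬝ᵥ u) = if x = 0 then 0 else 16 := by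
  have := sum_bit_mul_bit x x
  simpa [bit_mul_self] using this

theorem eight_dvd_sum_bit_mul_bit (x y : Fin 5 → ZMod 2) :
    8 ∣ ∑ u : Fin 5 → ZMod 2, bit (x ⬝ᵥ u) * bit (y ⬝ᵥ u) := by
  rw [sum_bit_mul_bit]
  split_ifs <;> norm_num

theorem sixteen_dvd_sum_bit (x : Fin 5 → ZMod 2) :
    16 ∣ ∑ u : Fin 5 → ZMod 2, bit (x ⬝ᵥ u) := by
  rw [sum_bit]
  split_ifs <;> norm_num

/-! ### Multisets in 𝔽₂⁵ and hyperplanes -/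

/-- The number of elements of the multiset with multiplicities `e` off the hyperplane `x^⊥`. -/
def offCount (e : (Fin 5 → ZMod 2) → ℤ) (x : Fin 5 → ZMod 2) : ℤ := ∑ u, e u * bit (x ⬝ᵥ u)

theorem offCount_nonneg {e : (Fin 5 → ZMod 2) → ℤ} (he : ∀ u, 0 ≤ e u) (x : Fin 5 → ZMod 2) :
    0 ≤ offCount e x :=
  Finset.sum_nonneg fun u _ => mul_nonneg (he u) (bit_nonneg _)

theorem offCount_le {e : (Fin 5 → ZMod 2) → ℤ} (he : ∀ u, 0 ≤ e u) (x : Fin 5 → ZMod 2) :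
    offCount e x ≤ ∑ u, e u := by
  refine Finset.sum_le_sum fun u _ => ?_
  have := he u
  rcases bit_eq_zero_or_one (x ⬝ᵥ u) with h | h <;> rw [h] <;> linarith

theorem sum_offCount {e : (Fin 5 → ZMod 2) → ℤ} (he0 : e 0 = 0) :
    ∑ x, offCount e x = 16 * ∑ u, e u := by
  unfold offCount
  rw [Finset.sum_comm, Finset.mul_sum]
  refine Finset.sum_congr rfl fun u _ => ?_
  rw [← Finset.mul_sum]
  simp only [dotProduct_comm _ u, sum_bit]
  split_ifs with h
  · simp [h, he0]
  · ring

theorem sum_offCount_sq {e : (Fin 5 → ZMod 2) → ℤ} (he0 : e 0 = 0) :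
    ∑ x, offCount e x ^ 2 = 8 * (∑ u, e u) ^ 2 + 8 * ∑ u, e u ^ 2 := by
  have h1 : ∀ x, offCount e x ^ 2 =
      ∑ u, ∑ v, e u * e v * (bit (u ⬝ᵥ x) * bit (v ⬝ᵥ x)) := by
    intro x
    rw [offCount, sq, Finset.sum_mul_sum]
    refine Finset.sum_congr rfl fun u _ => Finset.sum_congr rfl fun v _ => ?_
    rw [dotProduct_comm x u, dotProduct_comm x v]
    ring
  have h2 : ∀ u v, ∑ x : Fin 5 → ZMod 2, e u * e v * (bit (u ⬝ᵥ x) * bit (v ⬝ᵥ x)) =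
      8 * (e u * e v) + if u = v then 8 * e u ^ 2 else 0 := by
    intro u v
    rw [← Finset.mul_sum, sum_bit_mul_bit]
    by_cases hu : u = 0
    · simp [hu, he0]
    by_cases hv : v = 0
    · simp [hv, he0, hu]
    by_cases huv : u = v
    · simp only [hv, huv, or_self, if_true, if_false]
      ring
    · simp only [hu, hv, huv, or_self, if_false]
      ring
  simp only [h1]
  rw [Finset.sum_comm]
  simp only [Finset.sum_comm (s := Finset.univ) (t := Finset.univ)
    (f := fun x v => e _ * e v * (bit (_ ⬝ᵥ x) * bit (v ⬝ᵥ x)))]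
  simp only [h2, Finset.sum_add_distrib, Finset.sum_ite_eq, Finset.mem_univ, if_true]
  rw [sq, Finset.sum_mul_sum, Finset.mul_sum, Finset.mul_sum]
  simp only [Finset.mul_sum]

theorem sum_offCount_mul_sub {e : (Fin 5 → ZMod 2) → ℤ} (he0 : e 0 = 0) :
    ∑ x, offCount e x * (offCount e x - 4) =
      8 * (∑ u, e u) ^ 2 + 8 * ∑ u, e u ^ 2 - 64 * ∑ u, e u := by
  have : ∀ x, offCount e x * (offCount e x - 4) = offCount e x ^ 2 - 4 * offCount e x := by
    intro x; ring
  simp only [this, Finset.sum_sub_distrib, ← Finset.mul_sum, sum_offCount he0,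
    sum_offCount_sq he0]
  ring

/-- For `offCount e x = 4 * k` the term `offCount e x * (offCount e x - 4)` is 16k(k − 1), a
multiple of 32; the second moment carries only a factor 8. -/
theorem four_dvd_of_offCount {e : (Fin 5 → ZMod 2) → ℤ} (he0 : e 0 = 0)
    (hf : ∀ x, 4 ∣ offCount e x) : 4 ∣ (∑ u, e u) ^ 2 + ∑ u, e u ^ 2 := by
  have h : (32 : ℤ) ∣ ∑ x, offCount e x * (offCount e x - 4) := by
    refine Finset.dvd_sum fun x _ => ?_
    obtain ⟨k, hk⟩ := hf x
    obtain ⟨j, hj⟩ := (Int.even_mul_pred_self k)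
    exact ⟨j, by rw [hk]; linear_combination 16 * hj⟩
  rw [sum_offCount_mul_sub he0] at h
  omega

/-- No multiset of nine nonzero vectors meets the complement of every hyperplane in a multiple of
four elements. -/
theorem sum_ne_nine {e : (Fin 5 → ZMod 2) → ℤ} (he : ∀ u, 0 ≤ e u) (he0 : e 0 = 0)
    (hf : ∀ x, 4 ∣ offCount e x) : ∑ u, e u ≠ 9 := by
  intro hs
  -- Otherwise x^⊥ holds a single element. For each y the number of elements in x^⊥ off y^⊥ is even,
  -- hence zero, but summed over y it is 16.
  have h8 : ∀ x, offCount e x ≠ 8 := by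
    intro x hx
    have hpair : ∀ y, ∑ u, e u * ((1 - bit (x ⬝ᵥ u)) * bit (y ⬝ᵥ u)) = 0 := by
      intro y
      have h1 : 2 * ∑ u, e u * ((1 - bit (x ⬝ᵥ u)) * bit (y ⬝ᵥ u)) =
          offCount e y - offCount e x + offCount e (x + y) := by
        simp only [offCount, Finset.mul_sum, ← Finset.sum_sub_distrib, ← Finset.sum_add_distrib,
          add_dotProduct, bit_add]
        refine Finset.sum_congr rfl fun u _ => ?_
        ring
      have h2 : 0 ≤ ∑ u, e u * ((1 - bit (x ⬝ᵥ u)) * bit (y ⬝ᵥ u)) := by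
        refine Finset.sum_nonneg fun u _ => mul_nonneg (he u) ?_
        rcases bit_eq_zero_or_one (x ⬝ᵥ u) with h | h <;> simp [h, bit_nonneg]
      have h3 : ∑ u, e u * ((1 - bit (x ⬝ᵥ u)) * bit (y ⬝ᵥ u)) ≤
          ∑ u, e u - offCount e x := by
        rw [offCount, ← Finset.sum_sub_distrib]
        refine Finset.sum_le_sum fun u _ => ?_
        have := he u
        rcases bit_eq_zero_or_one (x ⬝ᵥ u) with h | h <;>
          rcases bit_eq_zero_or_one (y ⬝ᵥ u) with h' | h' <;> rw [h, h'] <;> linarith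
      have := hf y
      have := hf x
      have := hf (x + y)
      omega
    have hsum : ∑ y : Fin 5 → ZMod 2, ∑ u, e u * ((1 - bit (x ⬝ᵥ u)) * bit (y ⬝ᵥ u)) =
        16 * ∑ u, e u - 16 * offCount e x := by
      rw [Finset.sum_comm, offCount, Finset.mul_sum, Finset.mul_sum, ← Finset.sum_sub_distrib]
      refine Finset.sum_congr rfl fun u _ => ?_
      rw [← Finset.mul_sum, ← Finset.mul_sum]
      simp only [dotProduct_comm _ u, sum_bit]
      split_ifs with h
      · simp [h, he0]
      · ring
    simp only [hpair, Finset.sum_const_zero] at hsum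
    omega
  -- With only the values 0 and 4 left, every term vanishes, yet the sum is at least 8·81 − 64·9 >
  -- 0.
  have h0 : ∑ x, offCount e x * (offCount e x - 4) = 0 := by
    refine Finset.sum_eq_zero fun x _ => ?_
    have h1 := offCount_nonneg he x
    have h2 := offCount_le he x
    have h3 := hf x
    have h4 := h8 x
    obtain h | h : offCount e x = 0 ∨ offCount e x = 4 := by omega
    · rw [h]; norm_num
    · rw [h]; norm_num
  rw [sum_offCount_mul_sub he0, hs] at h0
  have : 0 ≤ ∑ u, e u ^ 2 := Finset.sum_nonneg fun u _ => sq_nonneg _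
  omega

/-- The number of vectors of odd multiplicity in the hyperplane `h^⊥`. -/
def oddCount (e : (Fin 5 → ZMod 2) → ℤ) (h : Fin 5 → ZMod 2) : ℤ :=
  ∑ u, (1 - bit (h ⬝ᵥ u)) * (e u % 2)

theorem oddCount_add_offCount_le {e : (Fin 5 → ZMod 2) → ℤ} (he : ∀ u, 0 ≤ e u)
    (h : Fin 5 → ZMod 2) : oddCount e h + offCount e h ≤ ∑ u, e u := by
  rw [oddCount, offCount, ← Finset.sum_add_distrib]
  refine Finset.sum_le_sum fun u _ => ?_
  have := he u
  rcases bit_eq_zero_or_one (h ⬝ᵥ u) with h | h <;> rw [h] <;> omega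

/-- The support lies in `h^⊥`, and a square is 0 or 1 mod 4 according to parity. -/
theorem four_dvd_sum_sq_sub_oddCount {e : (Fin 5 → ZMod 2) → ℤ} (he : ∀ u, 0 ≤ e u)
    {h : Fin 5 → ZMod 2} (h0 : offCount e h = 0) : 4 ∣ ∑ u, e u ^ 2 - oddCount e h := by
  rw [oddCount, ← Finset.sum_sub_distrib]
  refine Finset.dvd_sum fun u hu => ?_
  have hu0 : e u * bit (h ⬝ᵥ u) = 0 :=
    (Finset.sum_eq_zero_iff_of_nonneg fun u _ => mul_nonneg (he u) (bit_nonneg _)).1 h0 u hu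
  rcases mul_eq_zero.1 hu0 with h | h
  · simp [h]
  · rw [h]
    obtain ⟨k, hk | hk⟩ := Int.even_or_odd' (e u)
    · exact ⟨k ^ 2, by rw [hk]; simp; ring⟩
    · exact ⟨k ^ 2 + k, by rw [hk]; simp [Int.add_emod]; ring⟩

/-- The parity pattern of a multiset of at most nine nonzero vectors that meets all complements of
hyperplanes in multiples of four elements is not that of a nondegenerate quadratic form on a
hyperplane. -/
theorem oddCount_ne {e : (Fin 5 → ZMod 2) → ℤ} (he : ∀ u, 0 ≤ e u) (he0 : e 0 = 0)
    (hf : ∀ x, 4 ∣ offCount e x) (hs : ∑ u, e u ≤ 9) (h : Fin 5 → ZMod 2) :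
    ¬ ((2 ∣ ∑ u, e u) ∧ (oddCount e h = 6 ∨ oddCount e h = 10) ∨
      (¬ 2 ∣ ∑ u, e u) ∧ (oddCount e h = 5 ∨ oddCount e h = 9)) := by
  intro ho
  have h1 := sum_ne_nine he he0 hf
  have h2 := oddCount_add_offCount_le he h
  have h3 := hf h
  have h4 := offCount_nonneg he h
  -- At least 5 of at most 8 elements lie in h^⊥, so fewer than 4 lie off it; a total of 9 would
  -- have allowed 4.
  have h5 : offCount e h = 0 := by omega
  have h6 := four_dvd_sum_sq_sub_oddCount he h5
  have h7 := four_dvd_of_offCount he0 hf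
  obtain ⟨k, hk | hk⟩ := Int.even_or_odd' (∑ u, e u)
  · rw [hk] at h7
    have : (2 * k) ^ 2 = 4 * k ^ 2 := by ring
    omega
  · rw [hk] at h7
    have : (2 * k + 1) ^ 2 = 4 * (k ^ 2 + k) + 1 := by ring
    omega

/-! ### Weights, Gram form and Gauss sum -/

/-- The weight of the codeword `G u`. -/
def codeWt {n : ℕ} (G : Matrix (Fin n) (Fin 5) (ZMod 2)) (u : Fin 5 → ZMod 2) : ℤ :=
  ∑ i, bit (G i ⬝ᵥ u)

/-- The inner product of the codewords `G u` and `G v`. -/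
def gram {n : ℕ} (G : Matrix (Fin n) (Fin 5) (ZMod 2)) (u v : Fin 5 → ZMod 2) : ZMod 2 :=
  ∑ i, (G i ⬝ᵥ u) * (G i ⬝ᵥ v)

/-- The sum of the rows of `G`: the weight of `G u` is odd if and only if `u` is not orthogonal to
it. -/
def rowSum {n : ℕ} (G : Matrix (Fin n) (Fin 5) (ZMod 2)) : Fin 5 → ZMod 2 := ∑ i, G i

/-- The real part of `i ^ a`. -/
def cosQuarter (a : ℤ) : ℤ := if a % 4 = 0 then 1 else if a % 4 = 2 then -1 else 0

/-- The addition formula for the cosine: `cosQuarter (a - 1)` is the imaginary part of i^a. -/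
theorem cosQuarter_sub (a b : ℤ) :
    cosQuarter (a - b) = cosQuarter a * cosQuarter b + cosQuarter (a - 1) * cosQuarter (b - 1) := by
  have ha : a % 4 = 0 ∨ a % 4 = 1 ∨ a % 4 = 2 ∨ a % 4 = 3 := by omega
  have hb : b % 4 = 0 ∨ b % 4 = 1 ∨ b % 4 = 2 ∨ b % 4 = 3 := by omega
  unfold cosQuarter
  rcases ha with ha | ha | ha | ha <;> rcases hb with hb | hb | hb | hb <;>
    simp [Int.sub_emod, ha, hb]

theorem cosQuarter_sub_two_mul (a b : ℤ) :
    cosQuarter (a - 2 * b) = cosQuarter a * sgn (b : ZMod 2) := by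
  obtain ⟨k, rfl | rfl⟩ := Int.even_or_odd' b
  · have : ((2 * k : ℤ) : ZMod 2) = 0 := (ZMod.intCast_zmod_eq_zero_iff_dvd _ 2).2 ⟨k, by simp⟩
    rw [this, show sgn 0 = 1 from rfl, mul_one]
    unfold cosQuarter
    rw [show (a - 2 * (2 * k)) % 4 = a % 4 by omega]
  · have : ((2 * k + 1 : ℤ) : ZMod 2) = 1 := by
      have : ((2 * k : ℤ) : ZMod 2) = 0 := (ZMod.intCast_zmod_eq_zero_iff_dvd _ 2).2 ⟨k, by simp⟩
      rw [Int.cast_add, this]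
      simp
    rw [this, show sgn 1 = -1 from rfl]
    unfold cosQuarter
    split_ifs <;> omega

section
variable {n : ℕ} (G : Matrix (Fin n) (Fin 5) (ZMod 2))

theorem codeWt_zero : codeWt G 0 = 0 := by
  simp [codeWt, bit_zero]

theorem codeWt_add (u v : Fin 5 → ZMod 2) :
    codeWt G (u + v) =
      codeWt G u + codeWt G v - 2 * ∑ i, bit (G i ⬝ᵥ u) * bit (G i ⬝ᵥ v) := by
  simp only [codeWt, dotProduct_add, bit_add, Finset.sum_sub_distrib, Finset.sum_add_distrib,
    Finset.mul_sum]

theorem gram_eq_cast (u v : Fin 5 → ZMod 2) :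
    gram G u v = ((∑ i, bit (G i ⬝ᵥ u) * bit (G i ⬝ᵥ v) : ℤ) : ZMod 2) := by
  simp [gram, bit_cast]

theorem gram_add (u v v' : Fin 5 → ZMod 2) : gram G u (v + v') = gram G u v + gram G u v' := by
  simp [gram, dotProduct_add, mul_add, Finset.sum_add_distrib]

theorem bit_rowSum_dotProduct (u : Fin 5 → ZMod 2) : bit (rowSum G ⬝ᵥ u) = codeWt G u % 2 := by
  have h : rowSum G ⬝ᵥ u = ((codeWt G u : ℤ) : ZMod 2) := by
    simp only [rowSum, codeWt, Int.cast_sum, bit_cast]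
    exact sum_dotProduct _ _ _
  rw [h, bit, ZMod.val_intCast]
  rfl

/-- The square of the absolute value of the Gauss sum `∑ u, i ^ (codeWt G u)` of a nondegenerate
code. -/
theorem gauss_sum_sq (hG : ∀ u ≠ 0, ∃ v, gram G u v ≠ 0) :
    (∑ u, cosQuarter (codeWt G u)) ^ 2 + (∑ u, cosQuarter (codeWt G u - 1)) ^ 2 = 32 := by
  have h1 : ∀ z u, cosQuarter (codeWt G (u + z) - codeWt G u) =
      cosQuarter (codeWt G z) * sgn (gram G z u) := by
    intro z u
    rw [gram_eq_cast, ← cosQuarter_sub_two_mul, add_comm u z, codeWt_add]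
    congr 1
    ring
  have h2 : ∀ z, ∑ u, cosQuarter (codeWt G z) * sgn (gram G z u) = if z = 0 then 32 else 0 := by
    intro z
    split_ifs with hz
    · subst hz
      simp [codeWt_zero, gram, cosQuarter, sgn, bit_zero]
    · obtain ⟨v, hv⟩ := hG z hz
      have := sum_sgn_eq_zero (AddMonoidHom.mk' (fun u => gram G z u) (gram_add G z)) hv
      simp only [AddMonoidHom.mk'_apply] at this
      rw [← Finset.mul_sum, this, mul_zero]
  have h3 : ∀ u v, cosQuarter (codeWt G v - codeWt G u) =
      cosQuarter (codeWt G v) * cosQuarter (codeWt G u) +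
        cosQuarter (codeWt G v - 1) * cosQuarter (codeWt G u - 1) :=
    fun u v => cosQuarter_sub _ _
  have h4 : ∑ u, ∑ v, cosQuarter (codeWt G v - codeWt G u) = 32 := by
    have : ∀ u, ∑ v, cosQuarter (codeWt G v - codeWt G u) =
        ∑ z, cosQuarter (codeWt G z) * sgn (gram G z u) := by
      intro u
      simp only [← h1]
      exact (Equiv.sum_comp (Equiv.addLeft u) fun v => cosQuarter (codeWt G v - codeWt G u)).symm
    simp only [this]
    rw [Finset.sum_comm]
    simp [h2]
  simp only [h3, Finset.sum_add_distrib, ← Finset.mul_sum, ← Finset.sum_mul] at h4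
  rw [sq, sq, h4]

/-- 16 + 16 is the only way to write 32 as a sum of two squares. -/
theorem gauss_sum_re (hG : ∀ u ≠ 0, ∃ v, gram G u v ≠ 0) :
    ∑ u, cosQuarter (codeWt G u) = 4 ∨ ∑ u, cosQuarter (codeWt G u) = -4 := by
  have h := gauss_sum_sq G hG
  generalize ∑ u, cosQuarter (codeWt G u) = X at h ⊢
  generalize ∑ u, cosQuarter (codeWt G u - 1) = Y at h
  have h1 : X ≤ 5 := by nlinarith [sq_nonneg Y]
  have h2 : -5 ≤ X := by nlinarith [sq_nonneg Y]
  have h3 : Y ≤ 5 := by nlinarith [sq_nonneg X]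
  have h4 : -5 ≤ Y := by nlinarith [sq_nonneg X]
  interval_cases X <;> interval_cases Y <;> omega

/-- A nondegenerate code of odd dimension is not even. -/
theorem rowSum_ne_zero (hG : ∀ u ≠ 0, ∃ v, gram G u v ≠ 0) : rowSum G ≠ 0 := by
  intro h0
  have h := gauss_sum_sq G hG
  -- If all weights are even the imaginary part vanishes, and 16 + 0 is not 32.
  have hY : ∑ u, cosQuarter (codeWt G u - 1) = 0 := by
    refine Finset.sum_eq_zero fun u _ => ?_
    have hu := bit_rowSum_dotProduct G u
    rw [h0, zero_dotProduct, bit_zero] at hu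
    unfold cosQuarter
    split_ifs <;> omega
  rw [hY] at h
  rcases gauss_sum_re G hG with hX | hX <;> rw [hX] at h <;> norm_num at h

theorem sum_codeWt_dvd : 16 ∣ ∑ u, codeWt G u := by
  unfold codeWt
  rw [Finset.sum_comm]
  exact Finset.dvd_sum fun i _ => sixteen_dvd_sum_bit _

theorem sum_codeWt_le : ∑ u, codeWt G u ≤ 16 * n := by
  unfold codeWt
  rw [Finset.sum_comm]
  have : ∀ i ∈ Finset.univ, ∑ u, bit (G i ⬝ᵥ u) ≤ 16 := by
    intro i _
    rw [sum_bit]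
    split_ifs <;> norm_num
  refine (Finset.sum_le_card_nsmul _ _ _ this).trans ?_
  simp [mul_comm]

theorem eight_dvd_sum_codeWt_mul_bit (x : Fin 5 → ZMod 2) :
    8 ∣ ∑ u, codeWt G u * bit (x ⬝ᵥ u) := by
  simp only [codeWt, Finset.sum_mul]
  rw [Finset.sum_comm]
  exact Finset.dvd_sum fun i _ => eight_dvd_sum_bit_mul_bit _ _

/-- The Griesmer-type bound for binary LCD codes of dimension five. -/
theorem lcd_bound (hG : ∀ u ≠ 0, ∃ v, gram G u v ≠ 0) {d : ℤ} (hd : ∀ u ≠ 0, d ≤ codeWt G u) :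
    31 * d + 35 ≤ 16 * n := by
  by_contra! hlt
  have hh := rowSum_ne_zero G hG
  set h := rowSum G with hh_def
  -- D = ⌈d/2⌉; the sign τ makes the rounding in e the term `τ * bit (h ⬝ᵥ u)`, whose sums are
  -- controlled.
  obtain ⟨D, τ, hDτ⟩ : ∃ D τ : ℤ, d = 2 * D ∧ τ = -1 ∨ d = 2 * D - 1 ∧ τ = 1 := by
    obtain ⟨k, hk | hk⟩ := Int.even_or_odd' d
    · exact ⟨k, -1, Or.inl ⟨hk, rfl⟩⟩
    · exact ⟨k + 1, 1, Or.inr ⟨by omega, rfl⟩⟩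
  set e : (Fin 5 → ZMod 2) → ℤ := fun u => if u = 0 then 0 else (codeWt G u - d) / 2 with he_def
  have he0 : e 0 = 0 := by simp [he_def]
  have he : ∀ u, 0 ≤ e u := by
    intro u
    simp only [he_def]
    split_ifs with hu
    · rfl
    · have := hd u hu
      omega
  have hbit : ∀ u, bit (h ⬝ᵥ u) = codeWt G u % 2 := bit_rowSum_dotProduct G
  have h2e : ∀ u, 2 * e u =
      codeWt G u - 2 * D + τ * bit (h ⬝ᵥ u) + if u = 0 then 2 * D else 0 := by
    intro u
    by_cases hu : u = 0
    · simp [hu, he0, codeWt_zero, bit_zero]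
    · simp only [he_def, hu, if_false]
      rw [hbit]
      rcases hDτ with ⟨h1, rfl⟩ | ⟨h1, rfl⟩ <;> omega
  have hcard : Fintype.card (Fin 5 → ZMod 2) = 32 := by simp
  have hsum : 2 * ∑ u, e u = ∑ u, codeWt G u - 62 * D + 16 * τ := by
    rw [Finset.mul_sum]
    simp only [h2e, Finset.sum_add_distrib, Finset.sum_sub_distrib, ← Finset.mul_sum, sum_bit, hh,
      Finset.sum_ite_eq', Finset.sum_const, Finset.card_univ, hcard, Finset.mem_univ, if_true,
      if_false]
    simp
    ring
  -- Twice the total is at most 34 − 16 for even d and 3 + 16 for odd d.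
  have hs9 : ∑ u, e u ≤ 9 := by
    have := sum_codeWt_le G
    omega
  have hsD : 2 ∣ ∑ u, e u - D := by
    have := sum_codeWt_dvd G
    omega
  have hf : ∀ x, 4 ∣ offCount e x := by
    intro x
    have h2f : 2 * offCount e x = ∑ u, codeWt G u * bit (x ⬝ᵥ u) - 2 * D * ∑ u, bit (x ⬝ᵥ u) +
        τ * ∑ u, bit (h ⬝ᵥ u) * bit (x ⬝ᵥ u) := by
      simp only [offCount, Finset.mul_sum, ← Finset.sum_sub_distrib, ← Finset.sum_add_distrib]
      refine Finset.sum_congr rfl fun u _ => ?_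
      rw [← mul_assoc, h2e]
      split_ifs with hu
      · simp [hu, bit_zero]
      · ring
    have h1 : (8 : ℤ) ∣ 2 * offCount e x := by
      rw [h2f]
      refine dvd_add (dvd_sub (eight_dvd_sum_codeWt_mul_bit G x) ?_) ?_
      · exact Dvd.dvd.mul_left ((by norm_num : (8 : ℤ) ∣ 16).trans (sixteen_dvd_sum_bit x)) _
      · exact Dvd.dvd.mul_left (eight_dvd_sum_bit_mul_bit _ _) _
    omega
  refine oddCount_ne he he0 hf hs9 h ?_
  -- ε = (−1)^D.
  obtain ⟨ε, hε⟩ : ∃ ε : ℤ, 2 ∣ D ∧ ε = 1 ∨ ¬ 2 ∣ D ∧ ε = -1 := by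
    by_cases hD : 2 ∣ D
    · exact ⟨1, Or.inl ⟨hD, rfl⟩⟩
    · exact ⟨-1, Or.inr ⟨hD, rfl⟩⟩
  -- Odd weights contribute 0. An even weight at u ≠ 0 is 2D + 2e(u), giving ε(−1)^e(u); the zero
  -- word contributes 1 instead of ε.
  have hcos : ∀ u, cosQuarter (codeWt G u) =
      ε * ((1 - bit (h ⬝ᵥ u)) - 2 * ((1 - bit (h ⬝ᵥ u)) * (e u % 2))) +
        if u = 0 then 1 - ε else 0 := by
    intro u
    by_cases hu : u = 0
    · simp [hu, codeWt_zero, cosQuarter, bit_zero, he0]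
    · have h1 := h2e u
      have h2 := hbit u
      simp only [hu, if_false] at h1 ⊢
      unfold cosQuarter
      rcases bit_eq_zero_or_one (h ⬝ᵥ u) with h3 | h3 <;> rw [h3] at h1 h2 ⊢ <;>
        rcases hε with ⟨h4, rfl⟩ | ⟨h4, rfl⟩ <;> split_ifs <;> omega
  have hX : ∑ u, cosQuarter (codeWt G u) = ε * (16 - 2 * oddCount e h) + (1 - ε) := by
    simp only [hcos, Finset.sum_add_distrib, ← Finset.mul_sum, Finset.sum_sub_distrib, sum_bit, hh,
      Finset.sum_ite_eq', Finset.sum_const, Finset.card_univ, hcard, Finset.mem_univ, if_true,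
      if_false]
    simp only [oddCount]
    norm_num
  have hX4 := gauss_sum_re G hG
  rw [hX] at hX4
  rcases hε with ⟨h4, rfl⟩ | ⟨h4, rfl⟩ <;> omega

end

/-! ### From codes to generator matrices and back -/

theorem hammingNorm_mulVec {n : ℕ} (G : Matrix (Fin n) (Fin 5) (ZMod 2)) (u : Fin 5 → ZMod 2) :
    (hammingNorm (G.mulVec u) : ℤ) = codeWt G u := by
  have h : ∀ a : ZMod 2, bit a = if a ≠ 0 then 1 else 0 := by decide
  simp only [hammingNorm, codeWt, h, Finset.card_filter, Nat.cast_sum, Nat.cast_ite, Nat.cast_one,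
    Nat.cast_zero]
  rfl

/-- There is a matrix `G` with `n` rows such that the Gram matrix of the columns of `G` is
nondegenerate and all nonzero combinations of columns have weight at least `d`. -/
def HasLCDMatrix (n : ℕ) (d : ℤ) : Prop :=
  ∃ G : Matrix (Fin n) (Fin 5) (ZMod 2),
    (∀ u ≠ 0, ∃ v, gram G u v ≠ 0) ∧ ∀ u ≠ 0, d ≤ codeWt G u

theorem HasLCDMatrix.of_code {n : ℕ} {C : Submodule (ZMod 2) (Fin n → ZMod 2)}
    (hC : Module.finrank (ZMod 2) C = 5) (hL : IsLCD C) : HasLCDMatrix n (minWeight C) := by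
  let φ : (Fin 5 → ZMod 2) ≃ₗ[ZMod 2] C := LinearEquiv.ofFinrankEq _ _ (by simp [hC])
  set G := LinearMap.toMatrix' (C.subtype ∘ₗ φ.toLinearMap) with hG
  have hmul : ∀ u, G.mulVec u = φ u := by
    intro u
    rw [hG, LinearMap.toMatrix'_mulVec]
    rfl
  have hne : ∀ u ≠ 0, G.mulVec u ≠ 0 := by
    intro u hu h0
    rw [hmul] at h0
    exact hu (by simpa using h0)
  refine ⟨G, fun u hu => ?_, fun u hu => ?_⟩
  · by_contra! hc
    refine hne u hu ?_
    have hmem : G.mulVec u ∈ C ⊓ dualCode C := by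
      refine ⟨by rw [hmul]; exact (φ u).2, fun y hy => ?_⟩
      have := hc (φ.symm ⟨y, hy⟩)
      have hy' : G.mulVec (φ.symm ⟨y, hy⟩) = y := by rw [hmul, LinearEquiv.apply_symm_apply]
      rw [← hy']
      exact this
    rw [hL] at hmem
    exact hmem
  · rw [← hammingNorm_mulVec]
    have : minWeight C ≤ hammingNorm (G.mulVec u) :=
      Nat.sInf_le ⟨G.mulVec u, by rw [hmul]; exact (φ u).2, hne u hu, rfl⟩
    exact_mod_cast this

theorem HasLCDMatrix.exists_code {n : ℕ} {d : ℤ} (h : HasLCDMatrix n d) :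
    ∃ C : Submodule (ZMod 2) (Fin n → ZMod 2),
      Module.finrank (ZMod 2) C = 5 ∧ IsLCD C ∧ d ≤ minWeight C := by
  obtain ⟨G, hG, hd⟩ := h
  have hgram : ∀ u v, gram G u v = ∑ i, G.mulVec u i * G.mulVec v i := fun _ _ => rfl
  have hinj : Function.Injective G.mulVecLin := by
    rw [injective_iff_map_eq_zero]
    intro u hu
    by_contra hne
    obtain ⟨v, hv⟩ := hG u hne
    rw [Matrix.mulVecLin_apply] at hu
    exact hv (by simp [hgram, hu])
  refine ⟨LinearMap.range G.mulVecLin, ?_, ?_, ?_⟩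
  · rw [LinearMap.finrank_range_of_inj hinj]
    simp
  · rw [IsLCD, eq_bot_iff]
    rintro _ ⟨⟨u, rfl⟩, hu⟩
    by_contra hne
    obtain ⟨v, hv⟩ := hG u (by rintro rfl; exact hne (by simp))
    exact hv (hu _ ⟨v, rfl⟩)
  · have hmem : minWeight (LinearMap.range G.mulVecLin) ∈
        {w | ∃ x ∈ LinearMap.range G.mulVecLin, x ≠ 0 ∧ hammingNorm x = w} := by
      refine Nat.sInf_mem ⟨_, G.mulVecLin 1, ⟨1, rfl⟩, ?_, rfl⟩
      rw [Ne, map_eq_zero_iff _ hinj]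
      exact one_ne_zero
    obtain ⟨_, ⟨u, rfl⟩, hu, hw⟩ := hmem
    rw [← hw, Matrix.mulVecLin_apply, hammingNorm_mulVec]
    exact hd u (by rintro rfl; exact hu (by simp))

/-- The largest minimum weight is given by the bound `lcd_bound` whenever that bound is attained. -/
theorem largestLCDMinWeight_eq {n : ℕ} (h : HasLCDMatrix n ((16 * n - 35) / 31)) :
    (largestLCDMinWeight (ZMod 2) n 5 : ℤ) = (16 * n - 35) / 31 := by
  obtain ⟨C, hC, hL, hd⟩ := h.exists_code
  obtain ⟨⟨C', hC', hL', hd'⟩, hmax⟩ :=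
    isGreatest_largestLCDMinWeight (F := ZMod 2) (n := n) (k := 5) ⟨_, C, hC, hL, rfl⟩
  have h1 : minWeight C ≤ largestLCDMinWeight (ZMod 2) n 5 := hmax ⟨C, hC, hL, rfl⟩
  obtain ⟨G, hG, hw⟩ := HasLCDMatrix.of_code hC' hL'
  have h2 := lcd_bound G hG hw
  rw [hd'] at h2
  omega

/-! ### Extension by simplex codes -/

/-- Appending all nonzero vectors as rows changes the Gram matrix by zero and all weights by
sixteen. -/
theorem HasLCDMatrix.add_simplex {n : ℕ} {d : ℤ} (h : HasLCDMatrix n d) :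
    HasLCDMatrix (n + 31) (d + 16) := by
  obtain ⟨G, hG, hd⟩ := h
  have hcard : Fintype.card {x : Fin 5 → ZMod 2 // x ≠ 0} = 31 := by
    rw [Fintype.card_subtype_compl, Fintype.card_subtype_eq]
    simp
  let σ : Fin 31 ≃ {x : Fin 5 → ZMod 2 // x ≠ 0} := (Fintype.equivFinOfCardEq hcard).symm
  have hσ : ∀ {M : Type} [AddCommMonoid M] (F : (Fin 5 → ZMod 2) → M), F 0 = 0 →
      ∑ i, F (σ i) = ∑ x, F x := by
    intro M _ F hF
    rw [Equiv.sum_comp σ fun x => F x, ← Finset.sum_subtype ({x | x ≠ 0} : Finset _) (by simp) F,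
      Finset.sum_filter_of_ne]
    rintro x - hx rfl
    exact hx hF
  let G' : Matrix (Fin (n + 31)) (Fin 5) (ZMod 2) := Fin.append G fun i => (σ i : Fin 5 → ZMod 2)
  have hleft : ∀ i, G' (Fin.castAdd 31 i) = G i := Fin.append_left _ _
  have hright : ∀ i, G' (Fin.natAdd n i) = σ i := Fin.append_right _ _
  refine ⟨G', fun u hu => ?_, fun u hu => ?_⟩
  · obtain ⟨v, hv⟩ := hG u hu
    refine ⟨v, ?_⟩
    have h0 : ∑ i, ((σ i : Fin 5 → ZMod 2) ⬝ᵥ u) * ((σ i : Fin 5 → ZMod 2) ⬝ᵥ v) = 0 := by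
      rw [hσ (fun x => (x ⬝ᵥ u) * (x ⬝ᵥ v)) (by simp)]
      obtain ⟨k, hk⟩ := eight_dvd_sum_bit_mul_bit u v
      have := congrArg (Int.cast : ℤ → ZMod 2) hk
      simp only [Int.cast_sum, Int.cast_mul, bit_cast, dotProduct_comm u, dotProduct_comm v] at this
      rw [this, show ((8 : ℤ) : ZMod 2) = 0 from rfl, zero_mul]
    rw [gram, Fin.sum_univ_add]
    simp only [hleft, hright, h0, add_zero]
    exact hv
  · have h16 : ∑ i, bit ((σ i : Fin 5 → ZMod 2) ⬝ᵥ u) = 16 := by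
      rw [hσ (fun x => bit (x ⬝ᵥ u)) (by simp [bit_zero])]
      simp only [dotProduct_comm _ u, sum_bit, hu, if_false]
    rw [codeWt, Fin.sum_univ_add]
    simp only [hleft, hright, h16]
    have := hd u hu
    rw [codeWt] at this
    linarith

theorem HasLCDMatrix.add_simplexes {n : ℕ} {d : ℤ} (h : HasLCDMatrix n d) (q : ℕ) :
    HasLCDMatrix (n + 31 * q) (d + 16 * q) := by
  induction q with
  | zero => simpa using h
  | succ q ih =>
    have h1 : d + 16 * ((q + 1 : ℕ) : ℤ) = d + 16 * q + 16 := by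
      push_cast
      ring
    rw [h1, show n + 31 * (q + 1) = n + 31 * q + 31 by ring]
    exact ih.add_simplex

theorem largestLCDMinWeight_add {n : ℕ} (h : HasLCDMatrix n ((16 * n - 35) / 31)) (q : ℕ) :
    (largestLCDMinWeight (ZMod 2) (n + 31 * q) 5 : ℤ) =
      (16 * ((n + 31 * q : ℕ) : ℤ) - 35) / 31 := by
  apply largestLCDMinWeight_eq
  convert h.add_simplexes q using 1
  push_cast
  omega

/-! ### Optimal codes of small length -/

/-- The matrix whose rows are the binary expansions of the given numbers. -/
def binaryMatrix {n : ℕ} (r : Fin n → ℕ) : Matrix (Fin n) (Fin 5) (ZMod 2) :=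
  fun i j => if (r i).testBit j then 1 else 0

theorem hasLCDMatrix_length_6 : HasLCDMatrix 6 1 :=
  ⟨binaryMatrix ![3, 4, 5, 19, 25, 26],
    by decide +kernel, by decide +kernel⟩

theorem hasLCDMatrix_length_9 : HasLCDMatrix 9 3 :=
  ⟨binaryMatrix ![6, 7, 13, 16, 17, 19, 21, 25, 28],
    by decide +kernel, by decide +kernel⟩

theorem hasLCDMatrix_length_13 : HasLCDMatrix 13 5 :=
  ⟨binaryMatrix ![2, 3, 6, 7, 9, 10, 11, 12, 17, 18, 25, 28, 31],
    by decide +kernel, by decide +kernel⟩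

theorem hasLCDMatrix_length_15 : HasLCDMatrix 15 6 :=
  ⟨binaryMatrix ![1, 7, 11, 13, 14, 15, 16, 18, 20, 24, 25, 26, 28, 29, 31],
    by decide +kernel, by decide +kernel⟩

theorem hasLCDMatrix_length_17 : HasLCDMatrix 17 7 :=
  ⟨binaryMatrix ![1, 2, 3, 4, 6, 7, 8, 9, 13, 15, 16, 20, 21, 22, 25, 28, 30],
    by decide +kernel, by decide +kernel⟩

theorem hasLCDMatrix_length_21 : HasLCDMatrix 21 9 :=
  ⟨binaryMatrix ![1, 1, 3, 3, 4, 6, 8, 10, 15, 16, 18, 19, 21, 22, 23, 24, 26, 27, 29, 29, 31],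
    by decide +kernel, by decide +kernel⟩

theorem hasLCDMatrix_length_23 : HasLCDMatrix 23 10 :=
  ⟨binaryMatrix ![3, 4, 5, 8, 8, 9, 9, 11, 11, 14, 15, 16, 17, 18, 19, 21, 25, 27, 28, 29, 30,
    31, 31],
    by decide +kernel, by decide +kernel⟩

theorem hasLCDMatrix_length_24 : HasLCDMatrix 24 11 :=
  ⟨binaryMatrix ![1, 2, 4, 5, 6, 7, 8, 9, 10, 11, 12, 14, 15, 18, 20, 22, 23, 25, 26, 27, 28,
    29, 30, 31],
    by decide +kernel, by decide +kernel⟩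

theorem hasLCDMatrix_length_25 : HasLCDMatrix 25 11 :=
  ⟨binaryMatrix ![2, 3, 5, 6, 6, 7, 8, 11, 12, 12, 13, 13, 15, 15, 16, 16, 17, 18, 19, 24, 25,
    26, 26, 27, 30],
    by decide +kernel, by decide +kernel⟩

theorem hasLCDMatrix_length_27 : HasLCDMatrix 27 12 :=
  ⟨binaryMatrix ![1, 2, 4, 5, 5, 6, 7, 8, 10, 10, 11, 12, 12, 14, 15, 16, 17, 19, 20, 23, 24,
    25, 26, 27, 28, 29, 30],
    by decide +kernel, by decide +kernel⟩

theorem hasLCDMatrix_length_28 : HasLCDMatrix 28 13 :=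
  ⟨binaryMatrix ![1, 2, 3, 5, 6, 7, 8, 10, 11, 12, 13, 14, 14, 15, 17, 19, 21, 22, 23, 24, 25,
    26, 27, 28, 28, 29, 30, 31],
    by decide +kernel, by decide +kernel⟩

theorem hasLCDMatrix_length_29 : HasLCDMatrix 29 13 :=
  ⟨binaryMatrix ![1, 1, 2, 4, 5, 6, 7, 7, 8, 10, 12, 12, 14, 15, 16, 17, 18, 19, 20, 21, 22, 22,
    24, 27, 27, 29, 30, 30, 31],
    by decide +kernel, by decide +kernel⟩

theorem hasLCDMatrix_length_30 : HasLCDMatrix 30 14 :=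
  ⟨binaryMatrix ![1, 2, 2, 3, 4, 5, 7, 8, 9, 10, 11, 12, 13, 14, 15, 16, 17, 17, 18, 20, 21, 22,
    23, 24, 25, 27, 29, 30, 31, 31],
    by decide +kernel, by decide +kernel⟩

theorem hasLCDMatrix_length_31 : HasLCDMatrix 31 14 :=
  ⟨binaryMatrix ![4, 5, 6, 7, 8, 9, 9, 10, 12, 12, 13, 14, 14, 15, 16, 17, 19, 19, 23, 24, 24,
    25, 26, 26, 27, 27, 28, 28, 29, 30, 31],
    by decide +kernel, by decide +kernel⟩

theorem hasLCDMatrix_length_32 : HasLCDMatrix 32 15 :=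
  ⟨binaryMatrix ![1, 2, 2, 3, 4, 5, 6, 7, 7, 9, 10, 11, 12, 13, 14, 15, 15, 16, 17, 18, 19, 20,
    21, 23, 24, 25, 26, 27, 28, 30, 31, 31],
    by decide +kernel, by decide +kernel⟩

theorem largestLCDMinWeight_of_mod {n b : ℕ} {d : ℤ} (h : HasLCDMatrix b d)
    (hd : d = (16 * b - 35) / 31) (hb : b ≤ n) (hmod : n ≡ b [MOD 31]) :
    (largestLCDMinWeight (ZMod 2) n 5 : ℤ) = (16 * n - 35) / 31 := by
  obtain ⟨q, rfl⟩ : ∃ q, n = b + 31 * q := ⟨(n - b) / 31, by unfold Nat.ModEq at hmod; omega⟩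
  subst hd
  exact largestLCDMinWeight_add h q

theorem mainTheorem1 (n : ℕ) (hn : 5 ≤ n) :
    ((∃ t ∈ ({1, 9, 13, 15, 17, 21, 23, 24, 25, 27, 28, 29, 30} : Finset ℕ), n ≡ t [MOD 31]) →
      (largestLCDMinWeight (ZMod 2) n 5 : ℤ) = ⌊(16 * n : ℚ) / 31⌋ - 1) ∧
    ((∃ t ∈ ({0, 6} : Finset ℕ), n ≡ t [MOD 31]) →
      (largestLCDMinWeight (ZMod 2) n 5 : ℤ) = ⌊(16 * n : ℚ) / 31⌋ - 2) := by
  have hfloor : ⌊(16 * n : ℚ) / 31⌋ = (16 * n : ℤ) / 31 := by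
    have := Rat.floor_intCast_div_natCast (16 * n) 31
    push_cast at this
    exact this
  rw [hfloor]
  unfold Nat.ModEq
  refine ⟨?_, ?_⟩ <;> rintro ⟨t, ht, hmod⟩
  · have h : (largestLCDMinWeight (ZMod 2) n 5 : ℤ) = (16 * n - 35) / 31 := by
      simp only [Finset.mem_insert, Finset.mem_singleton] at ht
      rcases ht with rfl | rfl | rfl | rfl | rfl | rfl | rfl | rfl | rfl | rfl | rfl | rfl | rfl
      -- Since n ≥ 5, the residue 1 starts at length 32; likewise 0 starts at 31 below.
      · exact largestLCDMinWeight_of_mod hasLCDMatrix_length_32 (by norm_num)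
          (by omega) hmod
      · exact largestLCDMinWeight_of_mod hasLCDMatrix_length_9 (by norm_num)
          (by omega) hmod
      · exact largestLCDMinWeight_of_mod hasLCDMatrix_length_13 (by norm_num)
          (by omega) hmod
      · exact largestLCDMinWeight_of_mod hasLCDMatrix_length_15 (by norm_num)
          (by omega) hmod
      · exact largestLCDMinWeight_of_mod hasLCDMatrix_length_17 (by norm_num)
          (by omega) hmod
      · exact largestLCDMinWeight_of_mod hasLCDMatrix_length_21 (by norm_num)
          (by omega) hmod
      · exact largestLCDMinWeight_of_mod hasLCDMatrix_length_23 (by norm_num)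
          (by omega) hmod
      · exact largestLCDMinWeight_of_mod hasLCDMatrix_length_24 (by norm_num)
          (by omega) hmod
      · exact largestLCDMinWeight_of_mod hasLCDMatrix_length_25 (by norm_num)
          (by omega) hmod
      · exact largestLCDMinWeight_of_mod hasLCDMatrix_length_27 (by norm_num)
          (by omega) hmod
      · exact largestLCDMinWeight_of_mod hasLCDMatrix_length_28 (by norm_num)
          (by omega) hmod
      · exact largestLCDMinWeight_of_mod hasLCDMatrix_length_29 (by norm_num)
          (by omega) hmod
      · exact largestLCDMinWeight_of_mod hasLCDMatrix_length_30 (by norm_num)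
          (by omega) hmod
    -- As 35 = 31 + 4, the bound is ⌊16n/31⌋ − 1 when 16n mod 31 is at least 4, and ⌊16n/31⌋ − 2
    -- otherwise.
    rw [h]
    simp only [Finset.mem_insert, Finset.mem_singleton] at ht
    omega
  · have h : (largestLCDMinWeight (ZMod 2) n 5 : ℤ) = (16 * n - 35) / 31 := by
      simp only [Finset.mem_insert, Finset.mem_singleton] at ht
      rcases ht with rfl | rfl
      · exact largestLCDMinWeight_of_mod hasLCDMatrix_length_31 (by norm_num)
          (by omega) hmod
      · exact largestLCDMinWeight_of_mod hasLCDMatrix_length_6 (by norm_num)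
          (by omega) hmod
    rw [h]
    simp only [Finset.mem_insert, Finset.mem_singleton] at ht
    omega
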